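/- Theorem 1.4. Let $d\ge 1$, let $e_1,\dots,e_d$ be the canonical basis of $\mathbb Z^d$, $e_{d+i}=-e_i$ and $U=\{e_1,\dots,e_{2d}\}$. An environment is a family $\omega=(\omega(x,e))_{x\in\mathbb Z^d,\,e\in U}$ such that each $\omega(x,\cdot)$ is a probability vector on $U$. Let $P_{x,\omega}$ be the law of the Markov chain $(X_n)_{n\ge0}$ on $\mathbb Z^d$ started at $x$ that jumps from $y$ to $y+e$ with probability $\omega(y,e)$. For a probability measure $\mathbb P$ on environments, with expectation $\mathbb E$, put $P_x=\int P_{x,\omega}\,d\mathbb P(\omega)$. For $l$ in the unit sphere $\mathbb S^{d-1}$ and $L,\tilde L>0$ let $B_{l,L,\tilde L}=R\big((-L,L)\times(-\tilde L,\tilde L)^{d-1}\big)\cap\mathbb Z^d$, where $R$ is a linear isometry of $\mathbb R^d$ with $R(e_1)=l$, and let $T_B=\inf\{n\ge0:X_n\notin B\}$. For $M\ge1$ and $L\ge2$, condition $(P)_M|l$ holds on a box of size $L$ if, for every choice of $R$, there is $\tilde L\in(0,70L^3]$ such that the probability that the walk does not leave the box through its front side satisfies $$P_0\big(T_{B_{l,L,\tilde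 L}}=\infty\ \text{ or }\ X_{T_{B_{l,L,\tilde L}}}\cdot l<L\big)\le \frac1{L^M}.$$ Let $\eta_\alpha=\max_{e\in U}\mathbb E[\omega(0,e)^{-\alpha}]$, $\bar\alpha=\sup\{\alpha\ge0:\eta_\alpha<\infty\}\in[0,\infty]$ and $c_0(\alpha)=\frac23\,3^{120d^4+3000d(\log\eta_\alpha)^2}$. Condition $(P)_M|l$ is satisfied if it holds on a box of some size $L\ge\max(2,c_0)$, where $c_0=c_0(\bar\alpha/2)$ if $\bar\alpha<\infty$; if $\bar\alpha=\infty$, this is required with $c_0=c_0(\alpha)$ for every finite $\alpha\ge0$ (where $L$ may depend on $\alpha$). Suppose that under $\mathbb P$ the vectors $\omega(x,\cdot)$, $x\in\mathbb Z^d$, are i.i.d., that $\mathbb P$ is elliptic, i.e. $\mathbb P(\omega(x,e)>0)=1$ for all $x\in\mathbb Z^d$ and $e\in U$, and that there is a constant $r>1$ with $\omega(0,e_1)=r\,\omega(0,e_{1+d})$ $\mathbb P$-almost surely. Then there is $M\ge 15d+5$ such that $(P)_M|e_1$ is satisfied. -/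

import Mathlib

open MeasureTheory ProbabilityTheory
open scoped ENNReal NNReal

noncomputable section

namespace RWRE

/-- The lattice `ℤ^d`. -/
abbrev Site (d : ℕ) : Type := Fin d → ℤ

/-- Labels of the `2d` unit vectors: `inl i` stands for `e_i` and `inr i` for `e_{d+i} = -e_i`. -/
abbrev Dir (d : ℕ) : Type := Fin d ⊕ Fin d

/-- The unit vector of `ℤ^d` with a given label. -/
def step {d : ℕ} : Dir d → Site d
  | Sum.inl i => Pi.single i 1
  | Sum.inr i => -Pi.single i 1

/-- Environments: a probability vector on the `2d` directions at every site,
with the product (equivalently, Borel) σ-algebra. -/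
abbrev Env (d : ℕ) : Type := Site d → stdSimplex ℝ (Dir d)

/-- The transition probability `ω(x, e)`. -/
def prob {d : ℕ} (ω : Env d) (x : Site d) (e : Dir d) : ℝ := (ω x : Dir d → ℝ) e

/-- The law of the position after one step from `x` in the environment `ω`. -/
def stepLaw {d : ℕ} (ω : Env d) (x : Site d) : Measure (Site d) :=
  ∑ e : Dir d, ENNReal.ofReal (prob ω x e) • Measure.dirac (x + step e)

instance isProbabilityMeasure_stepLaw {d : ℕ} (ω : Env d) (x : Site d) :
    IsProbabilityMeasure (stepLaw ω x) := by
  constructor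
  have h0 : ∀ e, 0 ≤ prob ω x e := (ω x).2.1
  have h1 : ∑ e, prob ω x e = 1 := (ω x).2.2
  simp only [stepLaw, Measure.coe_finsetSum, Finset.sum_apply, Measure.smul_apply,
    measure_univ, smul_eq_mul, mul_one]
  rw [← ENNReal.ofReal_sum_of_nonneg (fun e _ => h0 e), h1, ENNReal.ofReal_one]

/-- The Markovian transition kernel from the past up to time `n` to the position at time `n + 1`:
only the position at time `n` matters. -/
def stepKernel {d : ℕ} (ω : Env d) (n : ℕ) :
    Kernel (Finset.Iic n → Site d) (Site d) :=
  Kernel.ofFunOfCountable fun h => stepLaw ω (h ⟨n, Finset.mem_Iic.2 le_rfl⟩)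

instance isMarkovKernel_stepKernel {d : ℕ} (ω : Env d) (n : ℕ) :
    IsMarkovKernel (stepKernel ω n) :=
  ⟨fun h => isProbabilityMeasure_stepLaw ω (h ⟨n, Finset.mem_Iic.2 le_rfl⟩)⟩

/-- The quenched law `P_{x,ω}` on trajectories: the law of the Markov chain in the environment `ω`
started at `x`. -/
def quenchedLaw {d : ℕ} (ω : Env d) (x : Site d) : Measure (ℕ → Site d) :=
  Kernel.traj (X := fun _ : ℕ => Site d) (stepKernel ω) 0 (fun _ => x)

/-- The annealed probability `P_x(A) = ∫ P_{x,ω}(A) dμ(ω)`. -/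
def annealedProb {d : ℕ} (μ : Measure (Env d)) (x : Site d) (A : Set (ℕ → Site d)) : ℝ≥0∞ :=
  ∫⁻ ω, quenchedLaw ω x A ∂μ

/-- The family `(ω(x))_x` is independent and identically distributed under `μ`. -/
def IsIID {d : ℕ} (μ : Measure (Env d)) : Prop :=
  iIndepFun (fun (x : Site d) (ω : Env d) => ω x) μ ∧
    ∀ x : Site d, IdentDistrib (fun ω : Env d => ω x) (fun ω : Env d => ω 0) μ μ

/-- Ellipticity: `μ(ω(x, e) > 0) = 1` for all `x` and `e`. -/
def IsElliptic {d : ℕ} (μ : Measure (Env d)) : Prop :=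
  ∀ (x : Site d) (e : Dir d), ∀ᵐ ω ∂μ, 0 < prob ω x e

/-- `η_α = max_e E[ω(0, e)^{-α}]`, with values in `[0, ∞]`. -/
def eta {d : ℕ} (μ : Measure (Env d)) (α : ℝ≥0) : ℝ≥0∞ :=
  ⨆ e : Dir d, ∫⁻ ω, ENNReal.ofReal (prob ω 0 e) ^ (-(α : ℝ)) ∂μ

/-- `sup {α ≥ 0 : η_α < ∞}`, with values in `[0, ∞]`. -/
def alphaBar {d : ℕ} (μ : Measure (Env d)) : ℝ≥0∞ :=
  ⨆ (α : ℝ≥0) (_ : eta μ α < ∞), (α : ℝ≥0∞)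

/-- The constant `(2/3) 3^{120 d^4 + 3000 d (log η_α)^2}`. -/
def sizeBound {d : ℕ} (μ : Measure (Env d)) (α : ℝ≥0) : ℝ :=
  2 / 3 * (3 : ℝ) ^ (120 * (d : ℝ) ^ 4 + 3000 * (d : ℝ) * Real.log (eta μ α).toReal ^ 2)

/-- A lattice point seen in Euclidean space. -/
def toEuclid {d : ℕ} (x : Site d) : EuclideanSpace ℝ (Fin d) :=
  WithLp.toLp 2 fun i => (x i : ℝ)

/-- The first unit vector `e_1` of `ℝ^d`. -/
def firstVec (d : ℕ) [NeZero d] : EuclideanSpace ℝ (Fin d) := EuclideanSpace.single 0 1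

/-- The box `R((-L, L) × (-L', L')^{d-1}) ∩ ℤ^d`. -/
def box {d : ℕ} [NeZero d] (R : EuclideanSpace ℝ (Fin d) ≃ₗᵢ[ℝ] EuclideanSpace ℝ (Fin d))
    (L L' : ℝ) : Set (Site d) :=
  {x | toEuclid x ∈
    R '' {y | y 0 ∈ Set.Ioo (-L) L ∧ ∀ j : Fin d, j ≠ 0 → y j ∈ Set.Ioo (-L') L'}}

/-- The first exit time `T_A = inf {n ≥ 0 : X_n ∉ A}`, infinite if the path never leaves `A`. -/
def exitTime {d : ℕ} (A : Set (Site d)) (X : ℕ → Site d) : ℕ∞ :=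
  ⨅ (n : ℕ) (_ : X n ∉ A), (n : ℕ∞)

/-- The event that the walk does not exit `A` at a point with `⟨X_T, l⟩ ≥ L`: either `T_A = ∞`
or `⟨X_{T_A}, l⟩ < L`. -/
def notFrontExit {d : ℕ} (A : Set (Site d)) (l : EuclideanSpace ℝ (Fin d)) (L : ℝ) :
    Set (ℕ → Site d) :=
  {X | ∀ n : ℕ, exitTime A X = n → inner ℝ (toEuclid (X n)) l < L}

/-- The polynomial condition with exponent `M` in direction `l` on a box of size `L`, whatever the
rotation `R` with `R e_1 = l` that is used to define the boxes. (Composing `R` with the reflection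
in a coordinate other than the first does not change the boxes, so that for `d ≥ 2` it is the same
to let `R` range over all linear isometries or over those of determinant one.) -/
def PolynomialConditionOnBox {d : ℕ} [NeZero d] (μ : Measure (Env d)) (M : ℝ)
    (l : EuclideanSpace ℝ (Fin d)) (L : ℝ) : Prop :=
  ∀ R : EuclideanSpace ℝ (Fin d) ≃ₗᵢ[ℝ] EuclideanSpace ℝ (Fin d), R (firstVec d) = l →
    ∃ L' : ℝ, 0 < L' ∧ L' ≤ 70 * L ^ 3 ∧
      annealedProb μ 0 (notFrontExit (box R L L') l L) ≤ ENNReal.ofReal (1 / L ^ M)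

/-- The polynomial condition `(P)_M | l`: it holds on a box of some size `L ≥ max (2, c_0)`, where
`c_0 = (2/3) 3^{120 d^4 + 3000 d (log η_α)^2}` with `α` half of `sup {α ≥ 0 : η_α < ∞}`.
If this supremum is infinite there is no such `α`; then every finite `α` is allowed in `c_0`,
and a size `L` is asked for each of them. -/
def PolynomialCondition {d : ℕ} [NeZero d] (μ : Measure (Env d)) (M : ℝ)
    (l : EuclideanSpace ℝ (Fin d)) : Prop :=
  ∀ α : ℝ≥0, (alphaBar μ ≠ ∞ → (α : ℝ≥0∞) = alphaBar μ / 2) →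
    ∃ L : ℝ, 2 ≤ L ∧ sizeBound μ α ≤ L ∧ PolynomialConditionOnBox μ M l L

end RWRE

end

/-!
Write `r = t ^ 2` with `t > 1`. If `b` denotes `ω(X_n, -e₁)`, then one step of the quenched walk
multiplies the mean of `t ^ (-X_n·e₁)` by exactly `1 - (t - 1) ^ 2 * b` (`sum_prob_mul_tilt`), a
factor that is at most one everywhere. At a site that the walk has not visited before, the
environment is independent of the past, so averaging over the environment replaces this factor by
its mean, which is at most some `Λ < 1` by ellipticity. Hence, with `D_n` the number of distinct
sites among `X_0, …, X_{n-1}`, the process `Λ ^ (-D_n) * t ^ (-X_n·e₁)` is a supermartingale under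
the annealed law, although the annealed walk is not Markovian (`lintegral_potential_succ_le`). No
moment assumption on `1 / ω(0, e)` is used: traps cost time, but time does not enter.

Take the box of length `L` and width `L ^ 2`. If the walk leaves it through the back side, the
factor `t ^ (-X_n·e₁)` is at least `t ^ L`. If it leaves it elsewhere, but not through the front, it
has visited at least `L ^ 2` sites, and `Λ ^ (-L ^ 2) * t ^ (-L)` is at least `t ^ L` once `L` is
large (`exists_highExit_of_notFrontExit`). The maximal inequality (`mul_tsum_highExit_le`) bounds
the probability of both by `t ^ (-L)`. Finally the box is finite and is left almost surely
(`quenchedLaw_stays_eq_zero`). The exponential bound beats any power of `L`, and it holds for all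
large integers `L`, so that every lower bound on the size of the box can be met.
-/

namespace RWRE

variable {d : ℕ}

/-! ### Path cylinders and the Markov property -/

/-- The path that follows `g` up to time `n` and stays at the origin afterwards. -/
def extendPath {n : ℕ} (g : Finset.Iic n → Site d) (k : ℕ) : Site d :=
  if h : k ≤ n then g ⟨k, Finset.mem_Iic.2 h⟩ else 0

lemma extendPath_of_le {n k : ℕ} (g : Finset.Iic n → Site d) (h : k ≤ n) :
    extendPath g k = g ⟨k, Finset.mem_Iic.2 h⟩ := dif_pos h

/-- The paths that agree with `h` up to time `n`. -/
def pathCylinder (n : ℕ) (h : ℕ → Site d) : Set (ℕ → Site d) := {X | ∀ k ≤ n, X k = h k}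

lemma dependsOn_apply_extendPath {β : Type*} {n : ℕ} {F : (ℕ → Site d) → β}
    (hF : DependsOn F (Set.Iic n)) (X : ℕ → Site d) :
    F X = F (extendPath (Preorder.frestrictLe (π := fun _ => Site d) n X)) :=
  hF fun _ hk => (extendPath_of_le (Preorder.frestrictLe (π := fun _ => Site d) n X) hk).symm

/-- A function of finitely many positions of the path is measurable, since the lattice is
countable. -/
lemma measurable_of_dependsOn_Iic {n : ℕ} {F : (ℕ → Site d) → ℝ≥0∞}
    (hF : DependsOn F (Set.Iic n)) : Measurable F := by
  have h : F = (fun g => F (extendPath g)) ∘ Preorder.frestrictLe (π := fun _ => Site d) n :=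
    funext fun X => dependsOn_apply_extendPath hF X
  rw [h]
  exact Measurable.of_discrete.comp (Preorder.measurable_frestrictLe n)

lemma preimage_frestrictLe_singleton {n : ℕ} (g : Finset.Iic n → Site d) :
    Preorder.frestrictLe (π := fun _ => Site d) n ⁻¹' {g} = pathCylinder n (extendPath g) := by
  ext X
  constructor
  · rintro h k hk
    rw [extendPath_of_le _ hk, ← (h : Preorder.frestrictLe (π := fun _ => Site d) n X = g)]
    rfl
  · intro h
    ext i : 1
    exact (h i (Finset.mem_Iic.1 i.2)).trans (extendPath_of_le _ (Finset.mem_Iic.1 i.2))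

lemma lintegral_stepLaw (ω : Env d) (x : Site d) (f : Site d → ℝ≥0∞) :
    ∫⁻ y, f y ∂stepLaw ω x = ∑ e, ENNReal.ofReal (prob ω x e) * f (x + step e) := by
  simp [stepLaw, lintegral_smul_measure, lintegral_dirac]

instance (ω : Env d) (x : Site d) : IsProbabilityMeasure (quenchedLaw ω x) := by
  unfold quenchedLaw; infer_instance

/-- An integral of a function of the first `n + 1` positions is a sum over path cylinders. -/
lemma lintegral_quenchedLaw_eq_tsum (ω : Env d) (x : Site d) {n : ℕ} {F : (ℕ → Site d) → ℝ≥0∞}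
    (hF : DependsOn F (Set.Iic n)) :
    ∫⁻ X, F X ∂quenchedLaw ω x =
      ∑' g : Finset.Iic n → Site d,
        F (extendPath g) * quenchedLaw ω x (pathCylinder n (extendPath g)) := by
  have hm := Preorder.measurable_frestrictLe (X := fun _ : ℕ => Site d) n
  calc ∫⁻ X, F X ∂quenchedLaw ω x
      = ∫⁻ X, F (extendPath (Preorder.frestrictLe (π := fun _ => Site d) n X))
          ∂quenchedLaw ω x := lintegral_congr fun X => dependsOn_apply_extendPath hF X
    _ = ∫⁻ g, F (extendPath g) ∂(quenchedLaw ω x).map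
          (Preorder.frestrictLe (π := fun _ => Site d) n) :=
        (lintegral_map (f := fun g => F (extendPath g)) Measurable.of_discrete hm).symm
    _ = _ := by
        rw [lintegral_countable']
        refine tsum_congr fun g => ?_
        rw [Measure.map_apply hm (measurableSet_singleton g), preimage_frestrictLe_singleton]

/-- The Markov property of the quenched walk, for functions of the first `n + 2` positions. -/
lemma lintegral_quenchedLaw_succ (ω : Env d) (x : Site d) {n : ℕ}
    {G : (ℕ → Site d) → Site d → ℝ≥0∞} (hG : ∀ y, DependsOn (fun X => G X y) (Set.Iic n)) :
    ∫⁻ X, G X (X (n + 1)) ∂quenchedLaw ω x =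
      ∫⁻ X, ∑ e, ENNReal.ofReal (prob ω (X n) e) * G X (X n + step e) ∂quenchedLaw ω x := by
  let κ : (k : ℕ) → Kernel (Finset.Iic k → Site d) (Site d) := stepKernel ω
  have hm := Preorder.measurable_frestrictLe (X := fun _ : ℕ => Site d) n
  have hGm : Measurable fun X : ℕ → Site d => G X (X (n + 1)) := by
    refine measurable_of_dependsOn_Iic (n := n + 1) fun X Y hXY => ?_
    rw [hXY (n + 1) (Set.mem_Iic.2 le_rfl)]
    exact hG _ fun k hk => hXY k (le_trans (Set.mem_Iic.1 hk) n.le_succ)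
  have hdep : DependsOn (fun X : ℕ → Site d =>
      ∑ e, ENNReal.ofReal (prob ω (X n) e) * G X (X n + step e)) (Set.Iic n) := by
    intro X Y hXY
    have h0 := hXY n (Set.mem_Iic.2 le_rfl)
    simp only [h0]
    exact Finset.sum_congr rfl fun e _ => congrArg _ (hG _ hXY)
  have hcomp := Kernel.traj_comp_partialTraj (X := fun _ : ℕ => Site d) (κ := κ) (Nat.zero_le n)
  calc ∫⁻ X, G X (X (n + 1)) ∂quenchedLaw ω x
      = ∫⁻ g, ∫⁻ X, G X (X (n + 1)) ∂Kernel.traj (X := fun _ : ℕ => Site d) κ n g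
          ∂Kernel.partialTraj (X := fun _ : ℕ => Site d) κ 0 n (fun _ => x) := by
        rw [← Kernel.lintegral_comp _ _ _ hGm, hcomp]; rfl
    _ = ∫⁻ g, ∑ e, ENNReal.ofReal (prob ω (extendPath g n) e) *
            G (extendPath g) (extendPath g n + step e)
          ∂Kernel.partialTraj (X := fun _ : ℕ => Site d) κ 0 n (fun _ => x) := by
        refine lintegral_congr fun g => ?_
        have h1 : ∀ X : ℕ → Site d,
            G (Function.updateFinset X (Finset.Iic n) g)
              (Function.updateFinset X (Finset.Iic n) g (n + 1)) =
            G (extendPath g) (X (n + 1)) := by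
          intro X
          have h2 : Function.updateFinset X (Finset.Iic n) g (n + 1) = X (n + 1) := by
            simp [Function.updateFinset]
          rw [h2]
          refine hG _ fun k hk => ?_
          have hk' : k ≤ n := hk
          simp [Function.updateFinset, extendPath, hk']
        rw [Kernel.lintegral_traj _ hGm]
        simp only [h1]
        have h3 := lintegral_map (μ := Kernel.traj (X := fun _ : ℕ => Site d) κ n g)
          (f := fun y => G (extendPath g) y) Measurable.of_discrete (measurable_pi_apply (n + 1))
        rw [← h3, ← Kernel.map_apply _ (measurable_pi_apply (n + 1)), Kernel.map_traj_succ_self]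
        have h4 : κ n g = stepLaw ω (extendPath g n) := by
          rw [extendPath_of_le g le_rfl]; rfl
        rw [h4, lintegral_stepLaw]
    _ = _ := by
        rw [← Kernel.traj_map_frestrictLe_apply, lintegral_map Measurable.of_discrete hm]
        exact lintegral_congr fun X => (dependsOn_apply_extendPath hdep X).symm

lemma dependsOn_indicator_pathCylinder (n : ℕ) (h : ℕ → Site d) :
    DependsOn ((pathCylinder n h).indicator (1 : (ℕ → Site d) → ℝ≥0∞)) (Set.Iic n) := by
  classical
  intro X Y hXY
  simp only [Set.indicator_apply]
  congr 1
  exact propext (forall₂_congr fun k hk => by rw [hXY k hk])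

lemma measurableSet_pathCylinder (n : ℕ) (h : ℕ → Site d) : MeasurableSet (pathCylinder n h) := by
  have := (measurable_of_dependsOn_Iic (dependsOn_indicator_pathCylinder n h))
  exact (measurable_indicator_const_iff 1).1 this

lemma quenchedLaw_apply_zero (ω : Env d) (x : Site d) : ∀ᵐ X ∂quenchedLaw ω x, X 0 = x := by
  have hm := Preorder.measurable_frestrictLe (X := fun _ : ℕ => Site d) 0
  have h := Kernel.traj_map_frestrictLe_apply (X := fun _ : ℕ => Site d) (κ := stepKernel ω)
    0 0 (fun _ => x)
  rw [Kernel.partialTraj_self, Kernel.id_apply] at h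
  have h2 : ∀ᵐ g ∂(quenchedLaw ω x).map (Preorder.frestrictLe (π := fun _ => Site d) 0),
      g = fun _ => x := by
    unfold quenchedLaw
    rw [h]
    exact (ae_dirac_iff (measurableSet_singleton _)).2 rfl
  filter_upwards [ae_of_ae_map hm.aemeasurable h2] with X hX
  exact congrFun hX ⟨0, by simp⟩

lemma quenchedLaw_pathCylinder_succ (ω : Env d) (x : Site d) (n : ℕ) (h : ℕ → Site d) :
    quenchedLaw ω x (pathCylinder (n + 1) h) =
      quenchedLaw ω x (pathCylinder n h) * stepLaw ω (h n) {h (n + 1)} := by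
  classical
  let G : (ℕ → Site d) → Site d → ℝ≥0∞ := fun X y =>
    (pathCylinder n h).indicator 1 X * ({h (n + 1)} : Set (Site d)).indicator 1 y
  have hG : ∀ y, DependsOn (fun X => G X y) (Set.Iic n) := fun y X Y hXY => by
    simp only [G]; rw [dependsOn_indicator_pathCylinder n h hXY]
  have h1 := lintegral_quenchedLaw_succ ω x hG
  have h2 : ∀ X : ℕ → Site d, G X (X (n + 1)) = (pathCylinder (n + 1) h).indicator 1 X := by
    intro X
    have : X ∈ pathCylinder (n + 1) h ↔ X ∈ pathCylinder n h ∧ X (n + 1) = h (n + 1) := by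
      simp only [pathCylinder, Set.mem_ofPred_eq]
      constructor
      · exact fun H => ⟨fun k hk => H k (by omega), H _ le_rfl⟩
      · rintro ⟨H, H'⟩ k hk
        rcases Nat.lt_or_ge k (n + 1) with hk' | hk'
        · exact H k (by omega)
        · obtain rfl : k = n + 1 := by omega
          exact H'
    by_cases ha : X ∈ pathCylinder n h <;> by_cases hb : X (n + 1) = h (n + 1) <;>
      simp [G, Set.indicator_apply, this, ha, hb]
  have h3 : ∀ X : ℕ → Site d,
      ∑ e, ENNReal.ofReal (prob ω (X n) e) * G X (X n + step e) =
        (pathCylinder n h).indicator (fun _ => stepLaw ω (h n) {h (n + 1)}) X := by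
    intro X
    by_cases ha : X ∈ pathCylinder n h
    · rw [Set.indicator_of_mem ha, ha n le_rfl, ← lintegral_indicator_one
        (measurableSet_singleton _), lintegral_stepLaw]
      simp [G, ha]
    · simp [G, ha]
  simp only [h2, h3] at h1
  rwa [lintegral_indicator_one (measurableSet_pathCylinder _ _),
    lintegral_indicator_const (measurableSet_pathCylinder _ _), mul_comm] at h1

/-- The quenched probability of a cylinder as a product of transition probabilities. -/
lemma quenchedLaw_pathCylinder (ω : Env d) (x : Site d) (n : ℕ) (h : ℕ → Site d) :
    quenchedLaw ω x (pathCylinder n h) =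
      (if h 0 = x then 1 else 0) * ∏ k ∈ Finset.range n, stepLaw ω (h k) {h (k + 1)} := by
  induction n with
  | zero =>
    have h0 := quenchedLaw_apply_zero ω x
    split_ifs with hx
    · simp only [Finset.range_zero, Finset.prod_empty, mul_one]
      rw [← prob_compl_eq_zero_iff (measurableSet_pathCylinder _ _)]
      rw [ae_iff] at h0
      refine measure_mono_null (fun X hX => ?_) h0
      refine fun hX0 : X 0 = x => hX fun k hk => ?_
      obtain rfl : k = 0 := by omega
      rw [hX0, hx]
    · rw [zero_mul]
      rw [ae_iff] at h0
      exact measure_mono_null (fun X hX hX0 => hx ((hX 0 le_rfl).symm.trans hX0)) h0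
  | succ n ih => rw [quenchedLaw_pathCylinder_succ, ih, Finset.prod_range_succ, mul_assoc]

lemma stepLaw_singleton (ω : Env d) (x y : Site d) :
    stepLaw ω x {y} = ∑ e, ENNReal.ofReal ((ω x : Dir d → ℝ) e) *
      ({y} : Set (Site d)).indicator 1 (x + step e) := by
  rw [← lintegral_indicator_one (measurableSet_singleton y), lintegral_stepLaw]
  rfl

lemma measurable_quenchedLaw_pathCylinder (x : Site d) (n : ℕ) (h : ℕ → Site d) :
    Measurable fun ω : Env d => quenchedLaw ω x (pathCylinder n h) := by
  simp only [quenchedLaw_pathCylinder, stepLaw_singleton]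
  refine Measurable.const_mul (Finset.measurable_prod _ fun k _ => ?_) _
  refine Finset.measurable_sum _ fun e _ => Measurable.mul_const ?_ _
  exact ((measurable_pi_apply e).comp
    (measurable_subtype_coe.comp (measurable_pi_apply (h k)))).ennreal_ofReal

lemma measurable_lintegral_quenchedLaw (x : Site d) {n : ℕ} {F : (ℕ → Site d) → ℝ≥0∞}
    (hF : DependsOn F (Set.Iic n)) : Measurable fun ω : Env d => ∫⁻ X, F X ∂quenchedLaw ω x := by
  simp only [lintegral_quenchedLaw_eq_tsum _ _ hF]
  exact Measurable.tsum fun g => (measurable_quenchedLaw_pathCylinder x n _).const_mul _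

/-- The walk only makes nearest-neighbour steps. -/
lemma quenchedLaw_ae_step (ω : Env d) (x : Site d) :
    ∀ᵐ X ∂quenchedLaw ω x, ∀ n, ∃ e, X (n + 1) = X n + step e := by
  classical
  rw [ae_all_iff]
  intro n
  let G : (ℕ → Site d) → Site d → ℝ≥0∞ := fun X y => if ∃ e, y = X n + step e then 0 else 1
  have hG : ∀ y, DependsOn (fun X => G X y) (Set.Iic n) := fun y X Y hXY => by
    simp only [G]; rw [hXY n (Set.mem_Iic.2 le_rfl)]
  have h1 := lintegral_quenchedLaw_succ ω x hG
  have hm : Measurable fun X : ℕ → Site d => G X (X (n + 1)) := by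
    refine measurable_of_dependsOn_Iic (n := n + 1) fun X Y hXY => ?_
    rw [hXY (n + 1) (Set.mem_Iic.2 le_rfl)]
    exact hG _ fun k hk => hXY k (le_trans (Set.mem_Iic.1 hk) n.le_succ)
  have h2 : ∀ X : ℕ → Site d,
      ∑ e, ENNReal.ofReal (prob ω (X n) e) * G X (X n + step e) = 0 := fun X =>
    Finset.sum_eq_zero fun e _ => by
      have : ∃ e', X n + step e = X n + step e' := ⟨e, rfl⟩
      simp only [G, if_pos this, mul_zero]
  simp only [h2, lintegral_zero] at h1
  filter_upwards [(lintegral_eq_zero_iff hm).1 h1] with X hX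
  by_contra hcon
  simp only [G, if_neg hcon] at hX
  exact one_ne_zero hX

/-! ### The tilt and its mean after one step -/

/-- The exponential weight `t ^ (-x·e₁)`. -/
noncomputable def tilt [NeZero d] (t : ℝ) (x : Site d) : ℝ≥0∞ := ENNReal.ofReal (t ^ (-(x 0)))

/-- The factor by which `tilt t` changes on average in one step of the walk from a site with
transition vector `v`, when `v(e₁) = t² v(-e₁)`. -/
noncomputable def damping [NeZero d] (t : ℝ) (v : stdSimplex ℝ (Dir d)) : ℝ≥0∞ :=
  ENNReal.ofReal (1 - (t - 1) ^ 2 * (v : Dir d → ℝ) (Sum.inr 0))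

/-- The sites visited strictly before time `n`. -/
def visited (n : ℕ) (X : ℕ → Site d) : Finset (Site d) := (Finset.range n).image X

lemma visited_succ (n : ℕ) (X : ℕ → Site d) : visited (n + 1) X = insert (X n) (visited n X) := by
  rw [visited, Finset.range_add_one, Finset.image_insert, visited]

lemma mem_visited {n k : ℕ} (X : ℕ → Site d) (h : k < n) : X k ∈ visited n X :=
  Finset.mem_image_of_mem X (Finset.mem_range.2 h)

lemma dependsOn_visited {n m : ℕ} (h : n ≤ m + 1) :
    DependsOn (visited (d := d) n) (Set.Iic m) := by
  intro X Y hXY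
  refine Finset.image_congr fun k hk => hXY k ?_
  have := Finset.mem_range.1 (Finset.mem_coe.1 hk)
  exact Set.mem_Iic.2 (by omega)

lemma damping_le_one [NeZero d] (t : ℝ) (v : stdSimplex ℝ (Dir d)) : damping t v ≤ 1 := by
  refine ENNReal.ofReal_le_one.2 ?_
  exact sub_le_self _ (mul_nonneg (sq_nonneg (t - 1)) (v.2.1 (Sum.inr 0)))

lemma damping_lt_one [NeZero d] {t : ℝ} (ht : 1 < t) {v : stdSimplex ℝ (Dir d)}
    (hv : 0 < (v : Dir d → ℝ) (Sum.inr 0)) : damping t v < 1 := by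
  refine ENNReal.ofReal_lt_one.2 ?_
  have := mul_pos (pow_pos (sub_pos.2 ht) 2) hv
  linarith

lemma measurable_damping [NeZero d] (t : ℝ) : Measurable (damping (d := d) t) :=
  ((((measurable_pi_apply (Sum.inr 0)).comp measurable_subtype_coe).const_mul _).const_sub
    _).ennreal_ofReal

lemma measurable_comp_site {φ : stdSimplex ℝ (Dir d) → ℝ≥0∞} (hφ : Measurable φ) (y : Site d) :
    Measurable fun ω : Env d => φ (ω y) := hφ.comp (measurable_pi_apply y)

lemma sum_prob_mul_tilt [NeZero d] {t : ℝ} (ht : 0 < t) (ω : Env d) (x : Site d)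
    (hr : prob ω x (Sum.inl 0) = t ^ 2 * prob ω x (Sum.inr 0)) :
    ∑ e, ENNReal.ofReal (prob ω x e) * tilt t (x + step e) = damping t (ω x) * tilt t x := by
  have h0 : ∀ e, 0 ≤ prob ω x e := (ω x).2.1
  have h1 : ∑ e, prob ω x e = 1 := (ω x).2.2
  have hkey : ∀ e : Dir d, prob ω x e * t ^ (-((x + step e) 0)) =
      (prob ω x e + (if e = Sum.inl 0 then prob ω x e * (t⁻¹ - 1) else 0) +
        (if e = Sum.inr 0 then prob ω x e * (t - 1) else 0)) * t ^ (-(x 0)) := by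
    rintro (i | i)
    · by_cases hi : i = 0
      · subst hi
        simp [step, zpow_add₀ ht.ne']
        ring
      · have hi' : (0 : Fin d) ≠ i := fun h => hi h.symm
        simp [step, hi, hi']
    · by_cases hi : i = 0
      · subst hi
        simp [step, zpow_add₀ ht.ne']
        ring
      · have hi' : (0 : Fin d) ≠ i := fun h => hi h.symm
        simp [step, hi, hi']
  have hpos : ∀ y : Site d, 0 ≤ t ^ (-(y 0)) := fun y => (zpow_pos ht _).le
  simp only [tilt, damping]
  rw [← ENNReal.ofReal_mul' (hpos x)]
  simp only [← ENNReal.ofReal_mul' (hpos _)]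
  rw [← ENNReal.ofReal_sum_of_nonneg fun e _ => mul_nonneg (h0 e) (hpos _)]
  congr 1
  rw [Finset.sum_congr rfl fun e _ => hkey e, ← Finset.sum_mul]
  congr 1
  rw [Finset.sum_add_distrib, Finset.sum_add_distrib, h1]
  simp only [Finset.sum_ite_eq', Finset.mem_univ, if_true]
  rw [hr]
  change _ = 1 - (t - 1) ^ 2 * prob ω x (Sum.inr 0)
  field_simp
  ring

/-- The mean of the tilt after a step, for a weight that depends on the past. -/
lemma lintegral_mul_tilt_succ [NeZero d] {t : ℝ} (ht : 0 < t) (ω : Env d) (x : Site d)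
    (hr : ∀ y, prob ω y (Sum.inl 0) = t ^ 2 * prob ω y (Sum.inr 0))
    {n : ℕ} {F : (ℕ → Site d) → ℝ≥0∞} (hF : DependsOn F (Set.Iic n)) :
    ∫⁻ X, F X * tilt t (X (n + 1)) ∂quenchedLaw ω x =
      ∫⁻ X, F X * tilt t (X n) * damping t (ω (X n)) ∂quenchedLaw ω x := by
  have h := lintegral_quenchedLaw_succ ω x (n := n) (G := fun X y => F X * tilt t y)
    fun y X Y hXY => by simp only [hF hXY]
  rw [h]
  refine lintegral_congr fun X => ?_
  rw [mul_assoc, mul_comm (tilt t (X n)), ← sum_prob_mul_tilt ht ω (X n) (hr _), Finset.mul_sum]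
  exact Finset.sum_congr rfl fun e _ => mul_left_comm _ _ _

/-! ### The environment at a site that has not been visited -/

/-- The probability of a path up to time `n` only involves the environment at the sites visited
before time `n`, so it is independent of the environment at a fresh site. -/
lemma lintegral_pathCylinder_mul_fresh (μ : Measure (Env d)) [IsProbabilityMeasure μ]
    (hiid : IsIID μ) (x : Site d) (n : ℕ) (h : ℕ → Site d) (hn : h n ∉ visited n h)
    {φ : stdSimplex ℝ (Dir d) → ℝ≥0∞} (hφ : Measurable φ) :
    ∫⁻ ω, quenchedLaw ω x (pathCylinder n h) * φ (ω (h n)) ∂μ =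
      (∫⁻ ω, quenchedLaw ω x (pathCylinder n h) ∂μ) * ∫⁻ ω, φ (ω 0) ∂μ := by
  have hind := hiid.1.indepFun_finset (visited n h) {h n} (by simpa using hn)
    (fun y => measurable_pi_apply y)
  let Φ : (visited n h → stdSimplex ℝ (Dir d)) → ℝ≥0∞ := fun v =>
    (if h 0 = x then 1 else 0) * ∏ k : Fin n, ∑ e,
      ENNReal.ofReal ((v ⟨h k, mem_visited h k.2⟩ : Dir d → ℝ) e) *
        ({h (k + 1)} : Set (Site d)).indicator 1 (h k + step e)
  have hΦ : Measurable Φ := by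
    refine Measurable.const_mul (Finset.measurable_prod _ fun k _ => ?_) _
    refine Finset.measurable_sum _ fun e _ => Measurable.mul_const ?_ _
    exact ((measurable_pi_apply e).comp
      (measurable_subtype_coe.comp (measurable_pi_apply _))).ennreal_ofReal
  let Ψ : (({h n} : Finset (Site d)) → stdSimplex ℝ (Dir d)) → ℝ≥0∞ := fun v =>
    φ (v ⟨h n, Finset.mem_singleton_self _⟩)
  have hΨ : Measurable Ψ := hφ.comp (measurable_pi_apply _)
  have hW : ∀ ω : Env d, quenchedLaw ω x (pathCylinder n h) = Φ fun y => ω y := by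
    intro ω
    simp only [quenchedLaw_pathCylinder, stepLaw_singleton, Φ]
    rw [Finset.prod_range fun k => ∑ e, ENNReal.ofReal ((ω (h k) : Dir d → ℝ) e) *
      ({h (k + 1)} : Set (Site d)).indicator 1 (h k + step e)]
  have hid : ∫⁻ ω, φ (ω (h n)) ∂μ = ∫⁻ ω, φ (ω 0) ∂μ :=
    ((hiid.2 (h n)).comp hφ).lintegral_eq
  rw [← hid]
  refine lintegral_mul_eq_lintegral_mul_lintegral_of_indepFun''
    (measurable_quenchedLaw_pathCylinder x n h).aemeasurable
    (measurable_comp_site hφ _).aemeasurable ?_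
  have := hind.comp hΦ hΨ
  rwa [show (fun ω => quenchedLaw ω x (pathCylinder n h)) =
    Φ ∘ fun (ω : Env d) (y : visited n h) => ω y from funext hW]

/-- Averaged over the environment, a factor `φ ≤ 1` evaluated at the present site gains `Λ`
whenever this site is visited for the first time. -/
lemma lintegral_lintegral_mul_le_of_fresh (μ : Measure (Env d)) [IsProbabilityMeasure μ]
    (hiid : IsIID μ) (x : Site d) {φ : stdSimplex ℝ (Dir d) → ℝ≥0∞} (hφ : Measurable φ)
    (hφ1 : ∀ v, φ v ≤ 1) {Λ : ℝ≥0∞} (hΛ : ∫⁻ ω, φ (ω 0) ∂μ ≤ Λ)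
    {n : ℕ} {F : (ℕ → Site d) → ℝ≥0∞} (hF : DependsOn F (Set.Iic n)) :
    ∫⁻ ω, ∫⁻ X, F X * φ (ω (X n)) ∂quenchedLaw ω x ∂μ ≤
      ∫⁻ ω, ∫⁻ X, F X * (if X n ∈ visited n X then 1 else Λ) ∂quenchedLaw ω x ∂μ := by
  have hn : ∀ X Y : ℕ → Site d, (∀ i ∈ Set.Iic n, X i = Y i) → X n = Y n := fun X Y hXY =>
    hXY n (Set.mem_Iic.2 le_rfl)
  have hF1 : ∀ ω : Env d, DependsOn (fun X => F X * φ (ω (X n))) (Set.Iic n) :=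
    fun ω X Y hXY => by simp only [hF hXY, hn X Y hXY]
  have hF2 : DependsOn (fun X => F X * (if X n ∈ visited n X then 1 else Λ)) (Set.Iic n) :=
    fun X Y hXY => by
      simp only [hF hXY, hn X Y hXY, dependsOn_visited (Nat.le_succ n) hXY]
  simp only [lintegral_quenchedLaw_eq_tsum _ _ hF2,
    fun ω => lintegral_quenchedLaw_eq_tsum ω x (hF1 ω)]
  have hmW := fun g : Finset.Iic n → Site d =>
    measurable_quenchedLaw_pathCylinder x n (extendPath g)
  have hmP : ∀ g : Finset.Iic n → Site d, Measurable fun ω : Env d =>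
      quenchedLaw ω x (pathCylinder n (extendPath g)) * φ (ω (extendPath g n)) :=
    fun g => (hmW g).mul (measurable_comp_site hφ _)
  have hcomm : ∀ (ω : Env d) (g : Finset.Iic n → Site d),
      F (extendPath g) * φ (ω (extendPath g n)) * quenchedLaw ω x (pathCylinder n (extendPath g)) =
      F (extendPath g) * (quenchedLaw ω x (pathCylinder n (extendPath g)) *
        φ (ω (extendPath g n))) := fun ω g => by ring
  simp only [hcomm]
  rw [lintegral_tsum fun g => ((hmP g).const_mul _).aemeasurable,
    lintegral_tsum fun g => ((hmW g).const_mul _).aemeasurable]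
  refine ENNReal.tsum_le_tsum fun g => ?_
  rw [lintegral_const_mul _ (hmW g), lintegral_const_mul _ (hmP g), mul_assoc]
  gcongr
  split_ifs with hv
  · rw [one_mul]
    exact lintegral_mono fun ω => mul_le_of_le_one_right' (hφ1 _)
  · rw [lintegral_pathCylinder_mul_fresh μ hiid x n _ hv hφ, mul_comm]
    gcongr

/-! ### The supermartingale -/

/-- The process `Λ ^ (-#{X_0, …, X_{n-1}}) t ^ (-X_n·e₁)`. -/
noncomputable def potential [NeZero d] (t : ℝ) (Λ : ℝ≥0∞) (n : ℕ) (X : ℕ → Site d) : ℝ≥0∞ :=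
  Λ⁻¹ ^ (visited n X).card * tilt t (X n)

lemma dependsOn_potential [NeZero d] (t : ℝ) (Λ : ℝ≥0∞) (n : ℕ) :
    DependsOn (potential (d := d) t Λ n) (Set.Iic n) := fun X Y hXY => by
  simp only [potential, dependsOn_visited (Nat.le_succ n) hXY, hXY n (Set.mem_Iic.2 le_rfl)]

/-- The paths that stay in `A` strictly before time `n`. -/
def staysBefore (A : Set (Site d)) (n : ℕ) : Set (ℕ → Site d) := {X | ∀ k < n, X k ∈ A}

lemma dependsOn_staysBefore (A : Set (Site d)) {n m : ℕ} (h : n ≤ m + 1) :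
    DependsOn (fun X => X ∈ staysBefore A n) (Set.Iic m) := fun X Y hXY =>
  propext (forall₂_congr fun k hk => by rw [hXY k (Set.mem_Iic.2 (by omega))])

lemma dependsOn_indicator {n : ℕ} {A : Set (ℕ → Site d)} {F : (ℕ → Site d) → ℝ≥0∞}
    (hA : DependsOn (fun X => X ∈ A) (Set.Iic n)) (hF : DependsOn F (Set.Iic n)) :
    DependsOn (A.indicator F) (Set.Iic n) := fun X Y hXY => by
  classical
  have h : (X ∈ A) = (Y ∈ A) := hA hXY
  simp only [Set.indicator_apply, h, hF hXY]

/-- The one-step inequality of the supermartingale stopped at the exit time of `A`. -/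
lemma lintegral_potential_succ_le [NeZero d] (μ : Measure (Env d)) [IsProbabilityMeasure μ]
    (hiid : IsIID μ) {t : ℝ} (ht : 0 < t)
    (hr : ∀ᵐ ω ∂μ, ∀ y, prob ω y (Sum.inl 0) = t ^ 2 * prob ω y (Sum.inr 0))
    {Λ : ℝ≥0∞} (hΛ : ∫⁻ ω, damping t (ω 0) ∂μ ≤ Λ) (hΛ0 : Λ ≠ 0) (hΛ1 : Λ ≠ ∞)
    (x : Site d) (A : Set (Site d)) (n : ℕ) :
    ∫⁻ ω, ∫⁻ X, (staysBefore A (n + 1)).indicator (potential t Λ (n + 1)) X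
        ∂quenchedLaw ω x ∂μ ≤
      ∫⁻ ω, ∫⁻ X, (staysBefore A (n + 1)).indicator (potential t Λ n) X ∂quenchedLaw ω x ∂μ := by
  classical
  let F : (ℕ → Site d) → ℝ≥0∞ :=
    (staysBefore A (n + 1)).indicator fun X => Λ⁻¹ ^ (visited (n + 1) X).card
  have hF : DependsOn F (Set.Iic n) := dependsOn_indicator (dependsOn_staysBefore A le_rfl)
    fun X Y hXY => by simp only [dependsOn_visited le_rfl hXY]
  have hF' : DependsOn (fun X => F X * tilt t (X n)) (Set.Iic n) := fun X Y hXY => by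
    simp only [hF hXY, hXY n (Set.mem_Iic.2 le_rfl)]
  calc ∫⁻ ω, ∫⁻ X, (staysBefore A (n + 1)).indicator (potential t Λ (n + 1)) X
        ∂quenchedLaw ω x ∂μ
      = ∫⁻ ω, ∫⁻ X, F X * tilt t (X n) * damping t (ω (X n)) ∂quenchedLaw ω x ∂μ := by
        refine lintegral_congr_ae ?_
        filter_upwards [hr] with ω hω
        rw [← lintegral_mul_tilt_succ ht ω x hω hF]
        refine lintegral_congr fun X => ?_
        by_cases hX : X ∈ staysBefore A (n + 1) <;> simp [F, hX, potential]
    _ ≤ _ := lintegral_lintegral_mul_le_of_fresh μ hiid x (measurable_damping t)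
        (damping_le_one t) hΛ hF'
    _ = _ := by
        refine lintegral_congr fun ω => lintegral_congr fun X => ?_
        by_cases hX : X ∈ staysBefore A (n + 1)
        · simp only [F, Set.indicator_of_mem hX, potential, visited_succ]
          split_ifs with hv
          · rw [Finset.insert_eq_of_mem hv, mul_one]
          · rw [Finset.card_insert_of_notMem hv, pow_succ, mul_right_comm, mul_assoc _ Λ⁻¹,
              ENNReal.inv_mul_cancel hΛ0 hΛ1, mul_one]
        · simp [F, hX]

/-- The paths that leave `A` at time `n`, at a point where the potential is at least `K`. -/
def highExit [NeZero d] (t : ℝ) (Λ K : ℝ≥0∞) (A : Set (Site d)) (n : ℕ) : Set (ℕ → Site d) :=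
  {X | X ∈ staysBefore A n ∧ X n ∉ A ∧ K ≤ potential t Λ n X}

lemma dependsOn_highExit [NeZero d] (t : ℝ) (Λ K : ℝ≥0∞) (A : Set (Site d)) (n : ℕ) :
    DependsOn (fun X => X ∈ highExit t Λ K A n) (Set.Iic n) := fun X Y hXY => by
  have h1 : (X ∈ staysBefore A n) = (Y ∈ staysBefore A n) :=
    dependsOn_staysBefore A (Nat.le_succ n) hXY
  simp only [highExit, Set.mem_ofPred_eq, h1, dependsOn_potential t Λ n hXY,
    hXY n (Set.mem_Iic.2 le_rfl)]

lemma measurableSet_highExit [NeZero d] (t : ℝ) (Λ K : ℝ≥0∞) (A : Set (Site d)) (n : ℕ) :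
    MeasurableSet (highExit t Λ K A n) :=
  (measurable_indicator_const_iff (1 : ℝ≥0∞)).1 (measurable_of_dependsOn_Iic
    (dependsOn_indicator (F := fun _ => 1) (dependsOn_highExit t Λ K A n) fun _ _ _ => rfl))

/-- The maximal inequality for the supermartingale. -/
lemma mul_tsum_highExit_le [NeZero d] (μ : Measure (Env d)) [IsProbabilityMeasure μ]
    (hiid : IsIID μ) {t : ℝ} (ht : 0 < t)
    (hr : ∀ᵐ ω ∂μ, ∀ y, prob ω y (Sum.inl 0) = t ^ 2 * prob ω y (Sum.inr 0))
    {Λ : ℝ≥0∞} (hΛ : ∫⁻ ω, damping t (ω 0) ∂μ ≤ Λ) (hΛ0 : Λ ≠ 0) (hΛ1 : Λ ≠ ∞)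
    (K : ℝ≥0∞) (A : Set (Site d)) :
    K * ∑' n, annealedProb μ 0 (highExit t Λ K A n) ≤ 1 := by
  classical
  let u : ℕ → ℝ≥0∞ := fun n =>
    ∫⁻ ω, ∫⁻ X, (staysBefore A n).indicator (potential t Λ n) X ∂quenchedLaw ω 0 ∂μ
  have hstep : ∀ n, K * annealedProb μ 0 (highExit t Λ K A n) + u (n + 1) ≤ u n := by
    intro n
    have hd1 : DependsOn ((highExit t Λ K A n).indicator fun _ => K) (Set.Iic n) :=
      dependsOn_indicator (dependsOn_highExit t Λ K A n) fun _ _ _ => rfl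
    have hd2 : DependsOn ((staysBefore A (n + 1)).indicator (potential t Λ n)) (Set.Iic n) :=
      dependsOn_indicator (dependsOn_staysBefore A le_rfl) (dependsOn_potential t Λ n)
    have h1 : K * annealedProb μ 0 (highExit t Λ K A n) ≤
        ∫⁻ ω, ∫⁻ X, (highExit t Λ K A n).indicator (fun _ => K) X ∂quenchedLaw ω 0 ∂μ := by
      simp only [lintegral_indicator_const (measurableSet_highExit t Λ K A n)]
      exact lintegral_const_mul_le _ _
    refine (add_le_add h1
      (lintegral_potential_succ_le μ hiid ht hr hΛ hΛ0 hΛ1 0 A n)).trans ?_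
    rw [← lintegral_add_left (measurable_lintegral_quenchedLaw 0 hd1)]
    refine lintegral_mono fun ω => ?_
    rw [← lintegral_add_left (measurable_of_dependsOn_Iic hd1)]
    refine lintegral_mono fun X => ?_
    have hs : X ∈ staysBefore A (n + 1) ↔ X ∈ staysBefore A n ∧ X n ∈ A :=
      ⟨fun H => ⟨fun k hk => H k (by omega), H n (by omega)⟩, fun H k hk => by
        rcases Nat.lt_succ_iff_lt_or_eq.1 hk with h | rfl
        exacts [H.1 k h, H.2]⟩
    by_cases hX : X ∈ staysBefore A n
    · rw [Set.indicator_of_mem hX]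
      by_cases hA : X n ∈ A
      · have : X ∉ highExit t Λ K A n := fun H => H.2.1 hA
        simp [this, hs, hX, hA]
      · by_cases hK : K ≤ potential t Λ n X
        · simp [hs, hA, Set.indicator_apply]
          split_ifs <;> simp [hK]
        · have : X ∉ highExit t Λ K A n := fun H => hK H.2.2
          simp [this, hs, hA]
    · have : X ∉ highExit t Λ K A n := fun H => hX H.1
      simp [this, hs, hX]
  have hsum : ∀ N, K * ∑ n ∈ Finset.range N, annealedProb μ 0 (highExit t Λ K A n) + u N ≤ u 0 := by
    intro N
    induction N with
    | zero => simp
    | succ N ih =>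
      refine le_trans ?_ ih
      rw [Finset.sum_range_succ, mul_add, add_assoc]
      exact add_le_add le_rfl (hstep N)
  have hu0 : u 0 ≤ 1 := by
    have : ∀ ω : Env d, ∫⁻ X, (staysBefore A 0).indicator (potential t Λ 0) X
        ∂quenchedLaw ω 0 = 1 := by
      intro ω
      have : ∀ᵐ X ∂quenchedLaw ω 0, (staysBefore A 0).indicator (potential t Λ 0) X = 1 := by
        filter_upwards [quenchedLaw_apply_zero ω 0] with X hX
        have : X ∈ staysBefore A 0 := fun k hk => absurd hk (Nat.not_lt_zero k)
        simp [this, potential, visited, tilt, hX]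
      rw [lintegral_congr_ae this]
      simp
    simp [u, this]
  rw [ENNReal.tsum_eq_iSup_nat, ENNReal.mul_iSup]
  exact iSup_le fun N => le_self_add.trans ((hsum N).trans hu0)

/-! ### Almost sure exit from finite sets -/

/-- In an elliptic environment the walk leaves finite sets. -/
lemma quenchedLaw_stays_eq_zero [NeZero d] {t : ℝ} (ht : 1 < t) (ω : Env d) (x : Site d)
    (hr : ∀ y, prob ω y (Sum.inl 0) = t ^ 2 * prob ω y (Sum.inr 0))
    (hell : ∀ y, 0 < prob ω y (Sum.inr 0)) {A : Set (Site d)} (hA : A.Finite) :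
    quenchedLaw ω x {X | ∀ n, X n ∈ A} = 0 := by
  classical
  have ht0 : 0 < t := zero_lt_one.trans ht
  -- A bound `θ < 1` for the damping, and a lower bound `m > 0` for the tilt, on the finite set.
  obtain ⟨θ, hθ1, hθ⟩ : ∃ θ < (1 : ℝ≥0∞), ∀ y ∈ A, damping t (ω y) ≤ θ := by
    refine ⟨hA.toFinset.sup fun y => damping t (ω y), ?_, fun y hy =>
      Finset.le_sup (f := fun y => damping t (ω y)) (hA.mem_toFinset.2 hy)⟩
    exact (Finset.sup_lt_iff (by simp)).2 fun y _ => damping_lt_one ht (hell y)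
  obtain ⟨m, hm0, hm⟩ : ∃ m > (0 : ℝ≥0∞), m ≠ ∞ ∧ ∀ y ∈ A, m ≤ tilt t y := by
    refine ⟨min 1 (hA.toFinset.inf fun y => tilt t y), ?_, ?_, fun y hy => (min_le_right _ _).trans
      (Finset.inf_le (f := fun y => tilt t y) (hA.mem_toFinset.2 hy))⟩
    · refine lt_min one_pos ((Finset.lt_inf_iff (by simp)).2 fun y _ => ?_)
      exact ENNReal.ofReal_pos.2 (zpow_pos ht0 _)
    · exact ((min_le_left _ _).trans_lt ENNReal.one_lt_top).ne
  have hS : MeasurableSet {X : ℕ → Site d | ∀ n, X n ∈ A} := by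
    rw [show {X : ℕ → Site d | ∀ n, X n ∈ A} = ⋂ n, (fun X => X n) ⁻¹' A by ext; simp]
    exact MeasurableSet.iInter fun n => measurable_pi_apply n hA.measurableSet
  let v : ℕ → ℝ≥0∞ := fun n =>
    ∫⁻ X, (staysBefore A n).indicator (fun X => tilt t (X n)) X ∂quenchedLaw ω x
  have hv0 : v 0 = tilt t x := by
    have : ∀ᵐ X ∂quenchedLaw ω x,
        (staysBefore A 0).indicator (fun X => tilt t (X 0)) X = tilt t x := by
      filter_upwards [quenchedLaw_apply_zero ω x] with X hX
      have : X ∈ staysBefore A 0 := fun k hk => absurd hk (Nat.not_lt_zero k)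
      simp [this, hX]
    simp [v, lintegral_congr_ae this]
  have hstep : ∀ n, v (n + 1) ≤ θ * v n := by
    intro n
    let F : (ℕ → Site d) → ℝ≥0∞ := (staysBefore A (n + 1)).indicator 1
    have hF : DependsOn F (Set.Iic n) :=
      dependsOn_indicator (dependsOn_staysBefore A le_rfl) fun _ _ _ => rfl
    have hd : DependsOn ((staysBefore A n).indicator fun X => tilt t (X n)) (Set.Iic n) :=
      dependsOn_indicator (dependsOn_staysBefore A (Nat.le_succ n))
        fun X Y hXY => by simp only [hXY n (Set.mem_Iic.2 le_rfl)]
    calc v (n + 1) = ∫⁻ X, F X * tilt t (X (n + 1)) ∂quenchedLaw ω x := by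
          refine lintegral_congr fun X => ?_
          by_cases hX : X ∈ staysBefore A (n + 1) <;> simp [F, hX]
      _ = ∫⁻ X, F X * tilt t (X n) * damping t (ω (X n)) ∂quenchedLaw ω x :=
          lintegral_mul_tilt_succ ht0 ω x hr hF
      _ ≤ ∫⁻ X, θ * (staysBefore A n).indicator (fun X => tilt t (X n)) X ∂quenchedLaw ω x := by
          refine lintegral_mono fun X => ?_
          by_cases hX : X ∈ staysBefore A (n + 1)
          · have hX' : X ∈ staysBefore A n := fun k hk => hX k (by omega)
            simp only [F, Set.indicator_of_mem hX, Set.indicator_of_mem hX', Pi.one_apply, one_mul]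
            rw [mul_comm]
            exact mul_le_mul_left (hθ _ (hX n (by omega))) _
          · simp [F, hX]
      _ = θ * v n := lintegral_const_mul _ (measurable_of_dependsOn_Iic hd)
  have hpow : ∀ n, v n ≤ θ ^ n * tilt t x := by
    intro n
    induction n with
    | zero => simp [hv0]
    | succ n ih =>
      rw [pow_succ', mul_assoc]
      exact (hstep n).trans (mul_le_mul_right ih _)
  have hle : ∀ n, m * quenchedLaw ω x {X | ∀ n, X n ∈ A} ≤ θ ^ n * tilt t x := by
    intro n
    refine le_trans ?_ (hpow n)
    rw [← lintegral_indicator_const hS]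
    refine lintegral_mono fun X => Set.indicator_apply_le fun hX : ∀ n, X n ∈ A => ?_
    have hX' : X ∈ staysBefore A n := fun k _ => hX k
    rw [Set.indicator_of_mem hX']
    exact hm.2 _ (hX n)
  have hlim : Filter.Tendsto (fun n => θ ^ n * tilt t x) Filter.atTop (nhds 0) := by
    have := ENNReal.Tendsto.mul_const (b := tilt t x)
      (ENNReal.tendsto_pow_atTop_nhds_zero_of_lt_one hθ1) (Or.inr ENNReal.ofReal_ne_top)
    rwa [zero_mul] at this
  have h0 : m * quenchedLaw ω x {X | ∀ n, X n ∈ A} = 0 :=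
    le_antisymm (ge_of_tendsto' hlim hle) zero_le
  exact (mul_eq_zero.1 h0).resolve_left hm0.ne'

/-! ### Geometry of the boxes -/

@[simp] lemma toEuclid_apply (x : Site d) (i : Fin d) : toEuclid x i = (x i : ℝ) := rfl

lemma norm_toEuclid_add_step_le (x : Site d) (e : Dir d) :
    ‖toEuclid (x + step e)‖ ≤ ‖toEuclid x‖ + 1 := by
  have h : toEuclid (x + step e) = toEuclid x + toEuclid (step e) := by
    ext i; simp
  rw [h]
  refine (norm_add_le _ _).trans (add_le_add le_rfl ?_)
  rcases e with i | i
  · have : toEuclid (step (Sum.inl i)) = EuclideanSpace.single i (1 : ℝ) := by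
      ext j; simp [step, Pi.single_apply]
    simp [this]
  · have : toEuclid (step (Sum.inr i)) = -EuclideanSpace.single i (1 : ℝ) := by
      ext j; simp [step, Pi.single_apply]
    simp [this]

/-- A nearest-neighbour path has to visit many sites in order to get far away. -/
lemma norm_toEuclid_le_card_visited {X : ℕ → Site d} (h0 : X 0 = 0)
    (hX : ∀ n, ∃ e, X (n + 1) = X n + step e) (n : ℕ) :
    ‖toEuclid (X n)‖ ≤ (visited n X).card := by
  have hstep : ∀ n, ‖toEuclid (X n)‖ + 1 ≤ (visited (n + 1) X).card := by
    intro n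
    induction n using Nat.strong_induction_on with
    | _ n ih =>
      by_cases hv : X n ∈ visited n X
      · -- An earlier visit to the same site already gives the bound.
        obtain ⟨k, hk, hkn⟩ := Finset.mem_image.1 hv
        have hk' := Finset.mem_range.1 hk
        rw [← hkn]
        refine (ih k hk').trans (Nat.cast_le.2 (Finset.card_le_card ?_))
        exact Finset.image_subset_image (Finset.range_subset_range.2 (by omega))
      · rw [visited_succ, Finset.card_insert_of_notMem hv, Nat.cast_add, Nat.cast_one]
        refine add_le_add ?_ le_rfl
        rcases n with _ | m
        · have : toEuclid (0 : Site d) = 0 := by ext i; simp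
          simp [h0, this]
        · obtain ⟨e, he⟩ := hX m
          rw [he]
          exact (norm_toEuclid_add_step_le _ _).trans (ih m m.lt_succ_self)
  rcases n with _ | m
  · have : toEuclid (0 : Site d) = 0 := by ext i; simp
    simp [h0, this]
  · obtain ⟨e, he⟩ := hX m
    rw [he]
    exact (norm_toEuclid_add_step_le _ _).trans (hstep m)

lemma inner_firstVec [NeZero d] (z : EuclideanSpace ℝ (Fin d)) : inner ℝ z (firstVec d) = z 0 := by
  simp [firstVec, EuclideanSpace.inner_single_right]

lemma symm_apply_zero_of_fix_firstVec [NeZero d]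
    {R : EuclideanSpace ℝ (Fin d) ≃ₗᵢ[ℝ] EuclideanSpace ℝ (Fin d)}
    (hR : R (firstVec d) = firstVec d) (z : EuclideanSpace ℝ (Fin d)) : R.symm z 0 = z 0 := by
  rw [← inner_firstVec, ← inner_firstVec z, ← R.inner_map_map, R.apply_symm_apply, hR]

lemma mem_box_of_norm_lt [NeZero d]
    {R : EuclideanSpace ℝ (Fin d) ≃ₗᵢ[ℝ] EuclideanSpace ℝ (Fin d)}
    (hR : R (firstVec d) = firstVec d) {L L' : ℝ} {x : Site d} (h1 : -L < x 0) (h2 : x 0 < L)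
    (h3 : ‖toEuclid x‖ < L') : x ∈ box R L L' := by
  refine ⟨R.symm (toEuclid x), ⟨?_, fun j _ => ?_⟩, R.apply_symm_apply _⟩
  · rw [symm_apply_zero_of_fix_firstVec hR]
    exact ⟨h1, h2⟩
  · have h := PiLp.norm_apply_le (R.symm (toEuclid x)) j
    rw [R.symm.norm_map, Real.norm_eq_abs] at h
    exact abs_lt.1 (h.trans_lt h3)

lemma finite_box [NeZero d] (R : EuclideanSpace ℝ (Fin d) ≃ₗᵢ[ℝ] EuclideanSpace ℝ (Fin d))
    (L L' : ℝ) : (box R L L').Finite := by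
  let C : ℝ := max L L'
  let N : ℤ := ⌈√(∑ _i : Fin d, C ^ 2)⌉
  refine (Set.finite_Icc (fun _ => -N : Site d) (fun _ => N)).subset ?_
  rintro x ⟨y, ⟨hy0, hy⟩, hyx⟩
  have hC : ∀ j, |y j| ≤ C := by
    intro j
    by_cases hj : j = 0
    · subst hj
      exact (abs_lt.2 hy0).le.trans (le_max_left _ _)
    · exact (abs_lt.2 (hy j hj)).le.trans (le_max_right _ _)
  have hnorm : ‖toEuclid x‖ ≤ N := by
    rw [← hyx, R.norm_map, EuclideanSpace.norm_eq]
    refine le_trans (Real.sqrt_le_sqrt (Finset.sum_le_sum fun j _ => ?_)) (Int.le_ceil _)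
    rw [Real.norm_eq_abs]
    exact pow_le_pow_left₀ (abs_nonneg _) (hC j) 2
  have hx : ∀ i, |x i| ≤ N := fun i => by
    have h := (PiLp.norm_apply_le (toEuclid x) i).trans hnorm
    rw [Real.norm_eq_abs, toEuclid_apply] at h
    exact_mod_cast h
  exact ⟨fun i => (abs_le.1 (hx i)).1, fun i => (abs_le.1 (hx i)).2⟩

/-- A path that does not leave the box of length `L` and width `L²` through its front side either
stays in the box for ever or leaves it at a point of high potential: at the back side because of
the tilt, at the other sides because of the many visited sites. -/
lemma exists_highExit_of_notFrontExit [NeZero d]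
    {R : EuclideanSpace ℝ (Fin d) ≃ₗᵢ[ℝ] EuclideanSpace ℝ (Fin d)}
    (hR : R (firstVec d) = firstVec d) {t : ℝ} (ht : 1 < t) {Λ : ℝ≥0∞} (hΛ : Λ ≤ 1) {L : ℕ}
    (hL : ENNReal.ofReal (t ^ (2 * L)) ≤ Λ⁻¹ ^ (L ^ 2)) {X : ℕ → Site d} (h0 : X 0 = 0)
    (hX : ∀ n, ∃ e, X (n + 1) = X n + step e)
    (hfront : X ∈ notFrontExit (box R L (L ^ 2 : ℝ)) (firstVec d) L)
    (hexit : ¬∀ n, X n ∈ box R L (L ^ 2 : ℝ)) :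
    ∃ n, X ∈ highExit t Λ (ENNReal.ofReal (t ^ L)) (box R L (L ^ 2 : ℝ)) n := by
  classical
  have ht0 : 0 < t := zero_lt_one.trans ht
  push Not at hexit
  have hn := Nat.find_spec hexit
  have hmin : ∀ k < Nat.find hexit, X k ∈ box R L (L ^ 2 : ℝ) := fun k hk =>
    not_not.1 (Nat.find_min hexit hk)
  set n := Nat.find hexit
  have hT : exitTime (box R L (L ^ 2 : ℝ)) X = n :=
    le_antisymm (iInf₂_le n hn) (le_iInf₂ fun m hm => Nat.cast_le.2 (Nat.find_min' hexit hm))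
  have hlt : X n 0 < (L : ℤ) := by
    have := hfront n hT
    rw [inner_firstVec, toEuclid_apply] at this
    exact_mod_cast this
  refine ⟨n, hmin, hn, ?_⟩
  have hΛ' : 1 ≤ Λ⁻¹ := ENNReal.one_le_inv.2 hΛ
  rw [potential, tilt]
  rcases le_or_gt (X n 0) (-(L : ℤ)) with hback | hback
  · refine le_mul_of_one_le_of_le (one_le_pow₀ hΛ') (ENNReal.ofReal_le_ofReal ?_)
    rw [← zpow_natCast]
    exact zpow_le_zpow_right₀ ht.le (by omega)
  · have hcard : L ^ 2 ≤ (visited n X).card := by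
      by_contra hcon
      refine hn (mem_box_of_norm_lt hR (by exact_mod_cast hback) (by exact_mod_cast hlt) ?_)
      refine (norm_toEuclid_le_card_visited h0 hX n).trans_lt ?_
      exact_mod_cast not_le.1 hcon
    calc ENNReal.ofReal (t ^ L)
        = ENNReal.ofReal (t ^ (2 * L)) * ENNReal.ofReal (t ^ (-(L : ℤ))) := by
          rw [← ENNReal.ofReal_mul (pow_pos ht0 _).le, ← zpow_natCast, ← zpow_natCast,
            ← zpow_add₀ ht0.ne']
          congr 2
          push_cast
          ring
      _ ≤ _ := mul_le_mul' (hL.trans (pow_le_pow_right₀ hΛ' hcard))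
          (ENNReal.ofReal_le_ofReal (zpow_le_zpow_right₀ ht.le (by omega)))

/-! ### The exponential bound -/

/-- The walk fails to leave a long box through its front side with exponentially small
probability. -/
lemma annealedProb_notFrontExit_le [NeZero d] (μ : Measure (Env d)) [IsProbabilityMeasure μ]
    (hiid : IsIID μ) (hell : IsElliptic μ) {t : ℝ} (ht : 1 < t)
    (hr : ∀ᵐ ω ∂μ, ∀ y, prob ω y (Sum.inl 0) = t ^ 2 * prob ω y (Sum.inr 0))
    {Λ : ℝ≥0∞} (hΛ : ∫⁻ ω, damping t (ω 0) ∂μ ≤ Λ) (hΛ0 : Λ ≠ 0) (hΛ1 : Λ ≤ 1)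
    {R : EuclideanSpace ℝ (Fin d) ≃ₗᵢ[ℝ] EuclideanSpace ℝ (Fin d)}
    (hR : R (firstVec d) = firstVec d) {L : ℕ}
    (hL : ENNReal.ofReal (t ^ (2 * L)) ≤ Λ⁻¹ ^ (L ^ 2)) :
    annealedProb μ 0 (notFrontExit (box R L (L ^ 2 : ℝ)) (firstVec d) L) ≤
      ENNReal.ofReal (1 / t ^ L) := by
  have ht0 : 0 < t := zero_lt_one.trans ht
  let A := box R L (L ^ 2 : ℝ)
  let K := ENNReal.ofReal (t ^ L)
  have hK : K * ∑' n, annealedProb μ 0 (highExit t Λ K A n) ≤ 1 :=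
    mul_tsum_highExit_le μ hiid ht0 hr hΛ hΛ0 (hΛ1.trans_lt ENNReal.one_lt_top).ne K A
  have hmeas : ∀ n, Measurable fun ω : Env d => quenchedLaw ω 0 (highExit t Λ K A n) := by
    intro n
    have hd : DependsOn ((highExit t Λ K A n).indicator (1 : (ℕ → Site d) → ℝ≥0∞)) (Set.Iic n) :=
      dependsOn_indicator (dependsOn_highExit t Λ K A n) fun _ _ _ => rfl
    simpa only [lintegral_indicator_one (measurableSet_highExit t Λ K A n)] using
      measurable_lintegral_quenchedLaw 0 hd
  have hpos : ∀ᵐ ω ∂μ, ∀ y, 0 < prob ω y (Sum.inr 0) :=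
    ae_all_iff.2 fun y => hell y (Sum.inr 0)
  have hsum : annealedProb μ 0 (notFrontExit A (firstVec d) L) ≤
      ∑' n, annealedProb μ 0 (highExit t Λ K A n) := by
    simp only [annealedProb]
    rw [← lintegral_tsum fun n => (hmeas n).aemeasurable]
    refine lintegral_mono_ae ?_
    filter_upwards [hr, hpos] with ω hω hω'
    refine le_trans (measure_mono_ae ?_) (measure_iUnion_le _)
    have hstay := quenchedLaw_stays_eq_zero ht ω 0 hω hω' (finite_box R L (L ^ 2 : ℝ))
    filter_upwards [quenchedLaw_apply_zero ω 0, quenchedLaw_ae_step ω 0,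
      measure_eq_zero_iff_ae_notMem.1 hstay] with X h0 hX hexit hfront
    exact Set.mem_iUnion.2 (exists_highExit_of_notFrontExit hR ht hΛ1 hL h0 hX hfront hexit)
  refine hsum.trans ?_
  rw [one_div, ENNReal.ofReal_inv_of_pos (pow_pos ht0 _), ENNReal.le_inv_iff_mul_le, mul_comm]
  exact hK

lemma eventually_ofReal_pow_le_inv_pow (t : ℝ) {Λ : ℝ≥0∞} (hΛ : Λ < 1) :
    ∀ᶠ L : ℕ in Filter.atTop, ENNReal.ofReal (t ^ (2 * L)) ≤ Λ⁻¹ ^ (L ^ 2) := by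
  have h := ENNReal.tendsto_pow_atTop_nhds_zero_of_lt_one hΛ
  have hpos : 0 < (ENNReal.ofReal (t ^ 2))⁻¹ := ENNReal.inv_pos.2 ENNReal.ofReal_ne_top
  filter_upwards [h.eventually_le_const hpos] with L hL
  rw [pow_mul, ENNReal.ofReal_pow (sq_nonneg t), sq L, pow_mul]
  refine pow_le_pow_left₀ zero_le ?_ L
  rwa [← ENNReal.inv_pow, ENNReal.le_inv_iff_le_inv]

lemma eventually_one_div_pow_le (k : ℕ) {t : ℝ} (ht : 1 < t) :
    ∀ᶠ L : ℕ in Filter.atTop, 1 / t ^ L ≤ 1 / (L : ℝ) ^ k := by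
  have h := tendsto_pow_const_div_const_pow_of_one_lt k ht
  filter_upwards [h.eventually_le_const one_pos, Filter.eventually_gt_atTop 0] with L hL hL0
  rw [div_le_one (pow_pos (zero_lt_one.trans ht) L)] at hL
  exact one_div_le_one_div_of_le (pow_pos (Nat.cast_pos.2 hL0) k) hL

end RWRE

theorem theorem1p4 (d : ℕ) [NeZero d] (μ : Measure (RWRE.Env d)) [IsProbabilityMeasure μ]
    (hiid : RWRE.IsIID μ) (hell : RWRE.IsElliptic μ)
    (hr : ∃ r : ℝ, 1 < r ∧
      ∀ᵐ ω ∂μ, RWRE.prob ω 0 (Sum.inl 0) = r * RWRE.prob ω 0 (Sum.inr 0)) :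
    ∃ M : ℝ, 15 * (d : ℝ) + 5 ≤ M ∧ RWRE.PolynomialCondition μ M (RWRE.firstVec d) := by
  obtain ⟨r, hr1, hr⟩ := hr
  obtain ⟨t, ht, rfl⟩ : ∃ t : ℝ, 1 < t ∧ t ^ 2 = r :=
    ⟨√r, Real.lt_sqrt_of_sq_lt (by simpa using hr1), Real.sq_sqrt (by linarith)⟩
  have hr' : ∀ᵐ ω ∂μ, ∀ y,
      RWRE.prob ω y (Sum.inl 0) = t ^ 2 * RWRE.prob ω y (Sum.inr 0) := by
    refine ae_all_iff.2 fun y => ?_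
    have hcoord : ∀ e : RWRE.Dir d, Measurable fun v : stdSimplex ℝ (RWRE.Dir d) =>
        (v : RWRE.Dir d → ℝ) e := fun e => (measurable_pi_apply e).comp measurable_subtype_coe
    exact (hiid.2 y).symm.ae_mem_snd
      (t := {v | (v : RWRE.Dir d → ℝ) (Sum.inl 0) = t ^ 2 * (v : RWRE.Dir d → ℝ) (Sum.inr 0)})
      (measurableSet_eq_fun (hcoord _) ((hcoord _).const_mul _)) hr
  -- The mean damping at a fresh site is smaller than one by ellipticity.
  obtain ⟨Λ, hΛ, hΛ0, hΛ1⟩ : ∃ Λ : ℝ≥0∞,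
      ∫⁻ ω, RWRE.damping t (ω 0) ∂μ ≤ Λ ∧ Λ ≠ 0 ∧ Λ < 1 := by
    have hlt : ∫⁻ ω, RWRE.damping t (ω 0) ∂μ < 1 := by
      have h1 : ∫⁻ ω, RWRE.damping t (ω 0) ∂μ ≠ ∞ := by
        refine ((lintegral_mono fun ω : RWRE.Env d => RWRE.damping_le_one t (ω 0)).trans_lt ?_).ne
        simp
      have h2 := lintegral_strict_mono (μ := μ) (f := fun ω => RWRE.damping t (ω 0))
        (g := fun _ => 1) (IsProbabilityMeasure.ne_zero μ) measurable_const.aemeasurable h1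
        ((hell 0 (Sum.inr 0)).mono fun ω hω => RWRE.damping_lt_one ht hω)
      simpa using h2
    refine ⟨max (∫⁻ ω, RWRE.damping t (ω 0) ∂μ) 2⁻¹, le_max_left _ _, ?_,
      max_lt hlt (ENNReal.inv_lt_one.2 ENNReal.one_lt_two)⟩
    exact ((ENNReal.inv_pos.2 (by simp)).trans_le (le_max_right _ _)).ne'
  refine ⟨(15 * d + 5 : ℕ), by push_cast; rfl, fun α _ => ?_⟩
  obtain ⟨L, hL1, hL2, hL3, hL4⟩ := ((RWRE.eventually_ofReal_pow_le_inv_pow t hΛ1).and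
    ((RWRE.eventually_one_div_pow_le (15 * d + 5) ht).and
    ((tendsto_natCast_atTop_atTop.eventually_ge_atTop (RWRE.sizeBound μ α)).and
      (Filter.eventually_ge_atTop 2)))).exists
  have hL4' : (2 : ℝ) ≤ L := by exact_mod_cast hL4
  refine ⟨L, hL4', hL3, fun R hR => ⟨(L : ℝ) ^ 2, by positivity, ?_, ?_⟩⟩
  · nlinarith [pow_pos (show (0 : ℝ) < L by linarith) 2]
  · refine (RWRE.annealedProb_notFrontExit_le μ hiid hell ht hr' hΛ hΛ0 hΛ1.le hR hL1).trans ?_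
    rw [Real.rpow_natCast]
    exact ENNReal.ofReal_le_ofReal hL2
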